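/- For positive integers $n, w$, let $\mathbb{Z}_n = \mathbb{Z}/n\mathbb{Z}$, and for a $w$-element subset $x \subseteq \mathbb{Z}_n$ let $\Delta(x) = \{a - b : a, b \in x,\ a \neq b\}$. A conflict-avoiding code of length $n$ and weight $w$ is a collection $\mathcal{C}$ of $w$-element subsets of $\mathbb{Z}_n$ such that $\Delta(x) \cap \Delta(y) = \varnothing$ for all distinct $x, y \in \mathcal{C}$; it is optimal if it has the maximal number of members among all conflict-avoiding codes of length $n$ and weight $w$. Let $p > 3$ be a prime with $2^{p-1} \not\equiv 1 \pmod{p^2}$ (a non-Wieferich prime) such that $4$ does not divide the multiplicative order of $2$ modulo $p$. Let $\ell = [\mathbb{Z}_p^{\times} : \langle -1, 2 \rangle]$ be the index of the subgroup generated by $-1$ and $2$ in $\mathbb{Z}_p^{\times}$, and suppose that $\ell$ is an odd prime. Then for every integer $k \geq 1$, optimal conflict-avoiding codes of length $p^k$ and weight $3$ exist, and each of them has exactly $$\frac{p^k - 1 - 2k\ell}{4} + k \left\lfloor \frac{\ell}{3} \right\rfloor$$ members. -/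

import Mathlib

/-- The difference set `Δ(x) = {a - b | a, b ∈ x, a ≠ b}` of a finite subset `x` of `ℤ/nℤ`. -/
def differenceSet {n : ℕ} (x : Finset (ZMod n)) : Finset (ZMod n) :=
  x.offDiag.image fun q => q.1 - q.2

/-- `C` is a conflict-avoiding code of length `n` and weight `w`: a collection of `w`-subsets of
`ℤ/nℤ` such that distinct members have disjoint difference sets. -/
structure IsCAC (n w : ℕ) (C : Finset (Finset (ZMod n))) : Prop where
  card_eq : ∀ x ∈ C, x.card = w
  disjoint : ∀ x ∈ C, ∀ y ∈ C, x ≠ y → Disjoint (differenceSet x) (differenceSet y)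

/-- A conflict-avoiding code is optimal if it has the maximal size among all conflict-avoiding
codes of the same length and weight. -/
structure IsOptimalCAC (n w : ℕ) (C : Finset (Finset (ZMod n))) : Prop where
  isCAC : IsCAC n w C
  card_le : ∀ D : Finset (Finset (ZMod n)), IsCAC n w D → D.card ≤ C.card

/-- The subgroup `⟨-1, 2⟩` of `(ℤ/pℤ)ˣ` (for odd `p`), generated by the units whose residue
class is `-1` or `2`. -/
def subgroupNegOneTwo (p : ℕ) : Subgroup (ZMod p)ˣ :=
  Subgroup.closure {u : (ZMod p)ˣ | (u : ZMod p) = -1 ∨ (u : ZMod p) = 2}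

/-- For a primitive `n`-th root of unity `ζ`, the sum of `(1 + ζ ^ i) ^ n` over `i < n` is `2n`. -/
theorem IsPrimitiveRoot.sum_one_add_pow_pow {R : Type*} [CommRing R] [IsDomain R] {ζ : R} {n : ℕ}
    (hζ : IsPrimitiveRoot ζ n) (hn : 0 < n) :
    ∑ i ∈ Finset.range n, (1 + ζ ^ i) ^ n = 2 * n := by
  have hgeom : ∀ m, 0 < m → m < n → ∑ i ∈ Finset.range n, (ζ ^ i) ^ m = 0 := by
    intro m hm hmn
    have h1 : ζ ^ m - 1 ≠ 0 := sub_ne_zero.2 (hζ.pow_ne_one_of_pos_of_lt hm.ne' hmn)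
    have h2 := geom_sum_mul (ζ ^ m) n
    rw [← pow_mul, mul_comm m n, pow_mul, hζ.pow_eq_one, one_pow, sub_self] at h2
    rw [← (mul_eq_zero.mp h2).resolve_right h1]
    exact Finset.sum_congr rfl fun i _ => by rw [← pow_mul, ← pow_mul, mul_comm]
  obtain ⟨m, rfl⟩ : ∃ m, n = m + 1 := ⟨n - 1, by omega⟩
  simp_rw [add_comm (1 : R), add_pow]
  rw [Finset.sum_comm, Finset.sum_range_succ, Finset.sum_range_succ', Finset.sum_eq_zero]
  · have : ∀ i, (ζ ^ i) ^ (m + 1) = 1 := fun i => by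
      rw [← pow_mul, mul_comm, pow_mul, hζ.pow_eq_one, one_pow]
    simp [this]
    ring
  · intro j hj
    rw [Finset.mem_range] at hj
    simp only [one_pow, mul_one]
    rw [← Finset.sum_mul, hgeom (j + 1) (by omega) (by omega), zero_mul]

/-- If `p = 2nℓ + 1` with `n`, `ℓ` odd, `ℓ ≥ 3` and `2 ∈ H = {x | x ^ (2n) = 1}`, then some `t ∉ H`
satisfies `t (t + 1) ∈ H`. -/
theorem exists_pow_ne_one_mul_add_one_pow_eq_one {p n ℓ : ℕ} [Fact p.Prime]
    (hpn : p = 2 * n * ℓ + 1) (hn : Odd n) (hℓ : Odd ℓ) (h3 : 3 ≤ ℓ)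
    (h2 : (2 : ZMod p) ^ (2 * n) = 1) :
    ∃ t : ZMod p, t ^ (2 * n) ≠ 1 ∧ (t * (t + 1)) ^ (2 * n) = 1 := by
  classical
  by_contra! hcon
  have hcon' : ∀ t : ZMod p, (t * (t + 1)) ^ (2 * n) = 1 → t ^ (2 * n) = 1 := by
    intro t ht
    by_contra h
    exact hcon t h ht
  have hn0 : 0 < n := hn.pos
  have h2n : 2 * n ≠ 0 := by omega
  have hp7 : 6 * n + 1 ≤ p := by rw [hpn]; nlinarith
  have hp2 : 2 < p := by omega
  have : Fact (2 < p) := ⟨hp2⟩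
  have h20 : (2 : ZMod p) ≠ 0 := by
    intro h
    rw [h, zero_pow h2n] at h2
    exact zero_ne_one h2
  have hhalf : p / 2 = n * ℓ := by
    rw [hpn, mul_assoc]; omega
  have hnl : Odd (n * ℓ) := hn.mul hℓ
  have hsq : ∀ x : ZMod p, x ≠ 0 → (IsSquare x ↔ x ^ (n * ℓ) = 1) := by
    intro x hx
    rw [ZMod.euler_criterion p hx, hhalf]
  have hpm : ∀ x : ZMod p, x ≠ 0 → x ^ (n * ℓ) = 1 ∨ x ^ (n * ℓ) = -1 := by
    intro x hx
    rw [← hhalf]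
    exact ZMod.pow_div_two_eq_neg_one_or_one p hx
  have h4 : (4 : ZMod p) ^ n = 1 := by
    rw [← h2, pow_mul]; norm_num
  have hne : ∀ {x : ZMod p} {m : ℕ}, m ≠ 0 → x ^ m = 1 → x ≠ 0 := by
    rintro x m hm h rfl
    rw [zero_pow hm] at h
    exact zero_ne_one h
  set B : Finset (ZMod p) :=
    Finset.univ.filter fun b => b ^ n = 1 ∧ b ≠ 1 ∧ IsSquare (1 - b) with hB
  set Q : Finset (ZMod p) := Finset.univ.filter fun q => q ^ n = 1 ∧ q ≠ 1 with hQ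
  set P : Finset (ZMod p) :=
    Finset.univ.filter fun q => q ^ n = 1 ∧ q ≠ 1 ∧ (1 + q) ^ (2 * n) = 1 with hP
  have hQB : Q.card ≤ 2 * B.card := by
    have hsub : Q ⊆ B ∪ B.image (fun b : ZMod p => b⁻¹) := by
      intro q hq
      simp only [hQ, Finset.mem_filter, Finset.mem_univ, true_and] at hq
      obtain ⟨hqn, hq1⟩ := hq
      have hq0 := hne hn0.ne' hqn
      have h1q : 1 - q ≠ 0 := fun h => hq1 (sub_eq_zero.mp h).symm
      simp only [Finset.mem_union, Finset.mem_image, hB, Finset.mem_filter, Finset.mem_univ,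
        true_and]
      by_cases hs : IsSquare (1 - q)
      · exact Or.inl ⟨hqn, hq1, hs⟩
      · right
        refine ⟨q⁻¹, ⟨by rw [inv_pow, hqn, inv_one], fun h => hq1 (inv_eq_one.mp h), ?_⟩,
          inv_inv q⟩
        have e : 1 - q⁻¹ = -((1 - q) * q⁻¹) := by field_simp; ring
        have hq' : (1 - q) ^ (n * ℓ) = -1 := (hpm _ h1q).resolve_left (fun h => hs ((hsq _ h1q).2 h))
        rw [hsq _ (by rw [e]; exact neg_ne_zero.2 (mul_ne_zero h1q (inv_ne_zero hq0))), e,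
          hnl.neg_pow, mul_pow, hq', inv_pow, pow_mul q, hqn]
        simp
    calc Q.card ≤ (B ∪ B.image (fun b : ZMod p => b⁻¹)).card := Finset.card_le_card hsub
      _ ≤ B.card + (B.image fun b : ZMod p => b⁻¹).card := Finset.card_union_le _ _
      _ ≤ B.card + B.card := Nat.add_le_add_left Finset.card_image_le _
      _ = 2 * B.card := by ring
  have hBP : 2 * B.card ≤ P.card := by
    refine Finset.mul_card_image_le_card_of_maps_to (f := fun q => 4 * q / (1 + q) ^ 2) ?_ 2 ?_
    · intro q hq
      simp only [hP, Finset.mem_filter, Finset.mem_univ, true_and] at hq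
      obtain ⟨hqn, hq1, hqs⟩ := hq
      have h1q : 1 + q ≠ 0 := hne h2n hqs
      simp only [hB, Finset.mem_filter, Finset.mem_univ, true_and]
      refine ⟨?_, ?_, ⟨(1 - q) / (1 + q), ?_⟩⟩
      · rw [div_pow, mul_pow, h4, hqn, ← pow_mul, hqs]; simp
      · intro h
        rw [div_eq_one_iff_eq (pow_ne_zero _ h1q)] at h
        have : (1 - q) ^ 2 = 0 := by linear_combination -h
        exact hq1 (sub_eq_zero.mp (pow_eq_zero_iff two_ne_zero |>.1 this)).symm
      · field_simp; ring
    · intro b hb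
      simp only [hB, Finset.mem_filter, Finset.mem_univ, true_and] at hb
      obtain ⟨hbn, hb1, s, hs⟩ := hb
      have hs0 : s ≠ 0 := by
        rintro rfl
        exact hb1 (by linear_combination -hs)
      have hb0 := hne hn0.ne' hbn
      have key : ∀ s : ZMod p, s ≠ 0 → 1 - b = s * s → 1 + s ≠ 0 ∧
          (1 - s) / (1 + s) ∈ P.filter (fun q => 4 * q / (1 + q) ^ 2 = b) := by
        intro s hs0 hs
        have hbs : b = (1 - s) * (1 + s) := by linear_combination -hs
        have hs1 : 1 + s ≠ 0 := by
          intro h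
          rw [h, mul_zero] at hbs
          exact hb0 hbs
        have ht : ((-s - 1) / 2 * ((-s - 1) / 2 + 1)) ^ (2 * n) = 1 := by
          have : (-s - 1) / 2 * ((-s - 1) / 2 + 1) = -(b / 2 ^ 2) := by
            rw [hbs]; field_simp; ring
          rw [this, (even_two_mul n).neg_pow, div_pow, mul_comm 2 n, pow_mul b, hbn, ← pow_mul,
            show 2 * (n * 2) = (2 * n) * 2 by ring, pow_mul, h2]
          simp
        have ht' := hcon' _ ht
        have h1s : (1 + s) ^ (2 * n) = 1 := by
          rw [show (-s - 1) / 2 = -((1 + s) / 2) by ring, (even_two_mul n).neg_pow, div_pow, h2,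
            div_one] at ht'
          exact ht'
        have e1 : (1 - s) / (1 + s) = b / (1 + s) ^ 2 := by rw [hbs]; field_simp
        have e2 : 1 + (1 - s) / (1 + s) = 2 / (1 + s) := by field_simp; ring
        refine ⟨hs1, ?_⟩
        simp only [hP, Finset.mem_filter, Finset.mem_univ, true_and]
        refine ⟨⟨?_, ?_, ?_⟩, ?_⟩
        · rw [e1, div_pow, hbn, ← pow_mul, h1s, div_one]
        · rw [Ne, div_eq_one_iff_eq hs1]
          intro h
          have : 2 * s = 0 := by linear_combination -h
          exact (mul_ne_zero h20 hs0) this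
        · rw [e2, div_pow, h2, h1s, div_one]
        · rw [e2, hbs]; field_simp; ring
      obtain ⟨ha, ha'⟩ := key s hs0 hs
      obtain ⟨hc, hc'⟩ := key (-s) (neg_ne_zero.2 hs0) (by rw [hs]; ring)
      have hab : (1 - s) / (1 + s) ≠ (1 - -s) / (1 + -s) := by
        rw [Ne, div_eq_div_iff ha hc]
        intro h
        have : 2 * (2 * s) = 0 := by linear_combination -h
        exact mul_ne_zero h20 (mul_ne_zero h20 hs0) this
      refine (Finset.card_pair hab).symm.le.trans (Finset.card_le_card ?_)
      intro x hx
      rw [Finset.mem_insert, Finset.mem_singleton] at hx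
      rcases hx with rfl | rfl <;> assumption
  have hPQ : P = Q := by
    refine Finset.eq_of_subset_of_card_le ?_ (hQB.trans hBP)
    intro q hq
    simp only [hP, hQ, Finset.mem_filter] at hq ⊢
    exact ⟨hq.1, hq.2.1, hq.2.2.1⟩
  have hall : ∀ q : ZMod p, q ^ n = 1 → (1 + q) ^ (2 * n) = 1 := by
    intro q hq
    by_cases h : q = 1
    · rw [h, one_add_one_eq_two, h2]
    · have : q ∈ P := by
        rw [hPQ]
        simp [hQ, hq, h]
      simp only [hP, Finset.mem_filter] at this
      exact this.2.2.2
  have hsign : ∀ q : ZMod p, q ^ n = 1 → ∃ e : ℤ, (e = 1 ∨ e = -1) ∧ (1 + q) ^ n = (e : ZMod p) := by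
    intro q hq
    have := hall q hq
    rw [mul_comm, pow_mul] at this
    rcases sq_eq_sq_iff_eq_or_eq_neg.mp (this.trans (one_pow 2).symm) with h | h
    · exact ⟨1, Or.inl rfl, by simp [h]⟩
    · exact ⟨-1, Or.inr rfl, by simp [h]⟩
  obtain ⟨g, hg⟩ := IsCyclic.exists_ofOrder_eq_natCard (α := (ZMod p)ˣ)
  have hg' : IsPrimitiveRoot (g : ZMod p) (p - 1) := by
    rw [Nat.card_eq_fintype_card, ZMod.card_units] at hg
    exact (IsPrimitiveRoot.coe_units_iff).2 (hg ▸ IsPrimitiveRoot.orderOf g)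
  have hζ := hg'.pow (a := 2 * ℓ) (b := n) (by omega) (by rw [hpn, Nat.add_sub_cancel]; ring)
  set ζ := (g : ZMod p) ^ (2 * ℓ)
  have hsum := hζ.sum_one_add_pow_pow hn0
  have hζn : ∀ i, (ζ ^ i) ^ n = 1 := fun i => by
    rw [← pow_mul, mul_comm, pow_mul, hζ.pow_eq_one, one_pow]
  choose e he he' using fun i => hsign (ζ ^ i) (hζn i)
  have hzero : ((2 * n - ∑ i ∈ Finset.range n, e i : ℤ) : ZMod p) = 0 := by
    push_cast
    rw [← hsum, sub_eq_zero]
    exact Finset.sum_congr rfl fun i _ => he' i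
  rw [ZMod.intCast_zmod_eq_zero_iff_dvd] at hzero
  have hup : ∑ i ∈ Finset.range n, e i ≤ n := by
    calc ∑ i ∈ Finset.range n, e i ≤ ∑ i ∈ Finset.range n, (1 : ℤ) :=
          Finset.sum_le_sum fun i _ => by rcases he i with h | h <;> rw [h]; norm_num
      _ = n := by simp
  have hlo : -(n : ℤ) ≤ ∑ i ∈ Finset.range n, e i := by
    calc -(n : ℤ) = ∑ i ∈ Finset.range n, (-1 : ℤ) := by simp
      _ ≤ _ := Finset.sum_le_sum fun i _ => by rcases he i with h | h <;> rw [h]; norm_num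
  have := Int.le_of_dvd (by omega) hzero
  omega

/-- The `p`-adic valuation of the least nonnegative representative of `z : ZMod (p ^ k)`. -/
def zmodLevel (p : ℕ) {k : ℕ} (z : ZMod (p ^ k)) : ℕ := padicValNat p z.val

/-- The residue modulo `p` of the `p`-free part of `z : ZMod (p ^ k)`. -/
def zmodResidue (p : ℕ) {k : ℕ} (z : ZMod (p ^ k)) : ZMod p :=
  ((z.val / p ^ zmodLevel p z : ℕ) : ZMod p)

/-- The colour of `z`: its level together with the `e`-th power of its residue. -/
def zmodColour (p e : ℕ) {k : ℕ} (z : ZMod (p ^ k)) : ℕ × ZMod p :=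
  (zmodLevel p z, zmodResidue p z ^ e)

section Colour

variable {p k : ℕ} [Fact p.Prime]

theorem zmod_level_residue_eq {v : ℕ} (hv : v < k) {u : ℤ} (hu : (u : ZMod p) ≠ 0) :
    zmodLevel p (((p : ℤ) ^ v * u : ℤ) : ZMod (p ^ k)) = v ∧
      zmodResidue p (((p : ℤ) ^ v * u : ℤ) : ZMod (p ^ k)) = u := by
  have hp := Fact.out (p := p.Prime)
  set z : ZMod (p ^ k) := (((p : ℤ) ^ v * u : ℤ) : ZMod (p ^ k)) with hz
  have h1 : ((z.val : ℤ) : ZMod (p ^ k)) = (((p : ℤ) ^ v * u : ℤ) : ZMod (p ^ k)) := by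
    rw [← hz]; simp
  rw [ZMod.intCast_eq_intCast_iff_dvd_sub] at h1
  obtain ⟨m, hm⟩ := h1
  obtain ⟨d, rfl⟩ : ∃ d, k = v + (d + 1) := ⟨k - v - 1, by omega⟩
  have hw : (z.val : ℤ) = (p : ℤ) ^ v * (u - p * (p ^ d * m)) := by
    push_cast at hm
    linear_combination -hm
  have hpv : (0 : ℤ) < (p : ℤ) ^ v := by have := hp.pos; positivity
  have hw0 : 0 ≤ u - p * (p ^ d * m) := by
    by_contra! h
    have : (z.val : ℤ) < 0 := by rw [hw]; exact mul_neg_of_pos_of_neg hpv h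
    omega
  obtain ⟨w, hwe⟩ := Int.eq_ofNat_of_zero_le hw0
  have hwu : ((w : ℕ) : ZMod p) = u := by
    have := congrArg (fun a : ℤ => (a : ZMod p)) hwe
    simpa using this.symm
  have hval : z.val = p ^ v * w := by
    rw [hwe] at hw
    exact_mod_cast hw
  have hpw : ¬ p ∣ w := by
    rw [← ZMod.natCast_eq_zero_iff, hwu]
    exact hu
  have hlev : zmodLevel p z = v := by
    rw [zmodLevel, hval, padicValNat.mul (pow_ne_zero _ hp.ne_zero) (fun h => hpw (by rw [h]; exact dvd_zero _)),
      padicValNat.prime_pow, padicValNat.eq_zero_of_not_dvd hpw, add_zero]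
  refine ⟨hlev, ?_⟩
  rw [zmodResidue, hlev, hval, Nat.mul_div_cancel_left _ (pow_pos hp.pos _), hwu]

theorem zmodColour_eq (e : ℕ) {v : ℕ} (hv : v < k) {u : ℤ} (hu : (u : ZMod p) ≠ 0) :
    zmodColour p e (((p : ℤ) ^ v * u : ℤ) : ZMod (p ^ k)) = (v, (u : ZMod p) ^ e) := by
  rw [zmodColour, (zmod_level_residue_eq hv hu).1, (zmod_level_residue_eq hv hu).2]

theorem exists_eq_pow_mul_of_ne_zero {z : ZMod (p ^ k)} (hz : z ≠ 0) :
    ∃ v < k, ∃ u : ℤ, (u : ZMod p) ≠ 0 ∧ z = (((p : ℤ) ^ v * u : ℤ) : ZMod (p ^ k)) := by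
  have hp := Fact.out (p := p.Prime)
  have hval : z.val ≠ 0 := fun h => hz ((ZMod.val_eq_zero z).1 h)
  obtain ⟨v, w, hw, hzw⟩ := Nat.exists_eq_pow_mul_and_not_dvd hval p hp.ne_one
  refine ⟨v, ?_, w, ?_, ?_⟩
  · by_contra! h
    have h1 : p ^ k ∣ z.val := hzw ▸ Dvd.dvd.mul_right (pow_dvd_pow p h) w
    exact absurd (Nat.le_of_dvd (Nat.pos_of_ne_zero hval) h1) (not_le.2 (ZMod.val_lt z))
  · rw [Int.cast_natCast, Ne, ZMod.natCast_eq_zero_iff]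
    exact hw
  · have : ((z.val : ℕ) : ZMod (p ^ k)) = ((p ^ v * w : ℕ) : ZMod (p ^ k)) := by rw [← hzw]
    rw [ZMod.natCast_zmod_val] at this
    rw [this]; push_cast; rfl

theorem zmodColour_neg {e : ℕ} (he : Even e) {z : ZMod (p ^ k)} (hz : z ≠ 0) :
    zmodColour p e (-z) = zmodColour p e z := by
  obtain ⟨v, hv, u, hu, rfl⟩ := exists_eq_pow_mul_of_ne_zero hz
  have : -(((p : ℤ) ^ v * u : ℤ) : ZMod (p ^ k)) = (((p : ℤ) ^ v * (-u) : ℤ) : ZMod (p ^ k)) := by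
    push_cast; ring
  rw [this, zmodColour_eq e hv hu, zmodColour_eq e hv (by simpa using hu), Int.cast_neg, he.neg_pow]

theorem zmodColour_two_mul {e : ℕ} (he : e ≠ 0) (h2 : (2 : ZMod p) ^ e = 1) {z : ZMod (p ^ k)}
    (hz : z ≠ 0) : zmodColour p e (2 * z) = zmodColour p e z := by
  obtain ⟨v, hv, u, hu, rfl⟩ := exists_eq_pow_mul_of_ne_zero hz
  have : 2 * (((p : ℤ) ^ v * u : ℤ) : ZMod (p ^ k)) = (((p : ℤ) ^ v * (2 * u) : ℤ) : ZMod (p ^ k)) := by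
    push_cast; ring
  have h20 : (2 : ZMod p) ≠ 0 := by
    intro h
    rw [h, zero_pow he] at h2
    exact zero_ne_one h2
  have e2 : ((2 * u : ℤ) : ZMod p) = 2 * u := by push_cast; ring
  rw [this, zmodColour_eq e hv hu, zmodColour_eq e hv (by rw [e2]; exact mul_ne_zero h20 hu), e2,
    mul_pow, h2, one_mul]

theorem zmodColour_add_of_level_lt (e : ℕ) {x y : ZMod (p ^ k)} (hx : x ≠ 0) (hy : y ≠ 0)
    (h : zmodLevel p x < zmodLevel p y) : zmodColour p e (x + y) = zmodColour p e x := by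
  obtain ⟨v, hv, u, hu, rfl⟩ := exists_eq_pow_mul_of_ne_zero hx
  obtain ⟨v', hv', u', hu', rfl⟩ := exists_eq_pow_mul_of_ne_zero hy
  rw [(zmod_level_residue_eq hv hu).1, (zmod_level_residue_eq hv' hu').1] at h
  obtain ⟨d, rfl⟩ : ∃ d, v' = v + (d + 1) := ⟨v' - v - 1, by omega⟩
  have e1 : (((p : ℤ) ^ v * u : ℤ) : ZMod (p ^ k)) + (((p : ℤ) ^ (v + (d + 1)) * u' : ℤ) : ZMod (p ^ k))
      = (((p : ℤ) ^ v * (u + p * (p ^ d * u')) : ℤ) : ZMod (p ^ k)) := by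
    push_cast; ring
  have e2 : ((u + p * (p ^ d * u') : ℤ) : ZMod p) = u := by simp
  rw [e1, zmodColour_eq e hv hu, zmodColour_eq e hv (by rwa [e2]), e2]

theorem zmodColour_of_add_add_eq_zero {e : ℕ} (he : Even e) {x y z : ZMod (p ^ k)} (hx : x ≠ 0)
    (hy : y ≠ 0) (hz : z ≠ 0) (h : x + y + z = 0) :
    zmodColour p e x = zmodColour p e y ∨ zmodColour p e y = zmodColour p e z ∨
      zmodColour p e z = zmodColour p e x ∨
      zmodLevel p x = zmodLevel p y ∧ zmodLevel p y = zmodLevel p z := by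
  have hz' : z = -(x + y) := by linear_combination h
  have hy' : y = -(x + z) := by linear_combination h
  have hxy : x + y ≠ 0 := fun h0 => hz (by rw [hz', h0, neg_zero])
  have hxz : x + z ≠ 0 := fun h0 => hy (by rw [hy', h0, neg_zero])
  have cz : zmodColour p e z = zmodColour p e (x + y) := by
    conv_lhs => rw [hz']
    exact zmodColour_neg he hxy
  have cy : zmodColour p e y = zmodColour p e (x + z) := by
    conv_lhs => rw [hy']
    exact zmodColour_neg he hxz
  rcases lt_trichotomy (zmodLevel p x) (zmodLevel p y) with h1 | h1 | h1
  · right; right; left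
    rw [cz, zmodColour_add_of_level_lt e hx hy h1]
  · rcases lt_trichotomy (zmodLevel p x) (zmodLevel p z) with h2 | h2 | h2
    · left
      rw [cy, zmodColour_add_of_level_lt e hx hz h2]
    · right; right; right
      exact ⟨h1, h1.symm.trans h2⟩
    · right; left
      rw [cy, add_comm, zmodColour_add_of_level_lt e hz hx h2]
  · right; left
    rw [cz, add_comm, zmodColour_add_of_level_lt e hy hx h1]

theorem zmodLevel_lt {z : ZMod (p ^ k)} (hz : z ≠ 0) : zmodLevel p z < k := by
  obtain ⟨v, hv, u, hu, rfl⟩ := exists_eq_pow_mul_of_ne_zero hz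
  rwa [(zmod_level_residue_eq hv hu).1]

theorem zmodResidue_ne_zero {z : ZMod (p ^ k)} (hz : z ≠ 0) : zmodResidue p z ≠ 0 := by
  obtain ⟨v, hv, u, hu, rfl⟩ := exists_eq_pow_mul_of_ne_zero hz
  rwa [(zmod_level_residue_eq hv hu).2]

open Classical in
theorem card_level_residue_le (v : ℕ) (S : Finset (ZMod p)) :
    (Finset.univ.filter fun z : ZMod (p ^ k) =>
      z ≠ 0 ∧ zmodLevel p z = v ∧ zmodResidue p z ∈ S).card ≤ S.card * p ^ (k - 1 - v) := by
  have hp := Fact.out (p := p.Prime)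
  rw [← Finset.card_range (p ^ (k - 1 - v)), ← Finset.card_product]
  refine Finset.card_le_card_of_injOn
    (fun z => (zmodResidue p z, z.val / p ^ v / p)) ?_ ?_
  · intro z hz
    simp only [Finset.coe_filter, Finset.mem_univ, true_and, Set.mem_ofPred_eq] at hz
    obtain ⟨hz0, rfl, hzS⟩ := hz
    have hk := zmodLevel_lt hz0
    simp only [Finset.coe_product, Set.mem_prod, Finset.mem_coe, Finset.mem_range]
    refine ⟨hzS, ?_⟩
    rw [Nat.div_div_eq_div_mul, ← pow_succ]
    refine Nat.div_lt_of_lt_mul ?_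
    rw [← pow_add, show zmodLevel p z + 1 + (k - 1 - zmodLevel p z) = k by omega]
    exact ZMod.val_lt z
  · intro z hz z' hz' h
    simp only [Finset.coe_filter, Finset.mem_univ, true_and, Set.mem_ofPred_eq] at hz hz'
    obtain ⟨hz0, hzv, -⟩ := hz
    obtain ⟨hz0', hzv', -⟩ := hz'
    simp only [Prod.mk.injEq, zmodResidue, hzv, hzv'] at h
    obtain ⟨h1, h2⟩ := h
    rw [ZMod.natCast_eq_natCast_iff'] at h1
    have h3 : z.val / p ^ v = z'.val / p ^ v := by
      rw [← Nat.div_add_mod (z.val / p ^ v) p, h1, h2, Nat.div_add_mod]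
    have hd : p ^ v ∣ z.val := hzv ▸ pow_padicValNat_dvd
    have hd' : p ^ v ∣ z'.val := hzv' ▸ pow_padicValNat_dvd
    apply ZMod.val_injective
    rw [← Nat.mul_div_cancel' hd, h3, Nat.mul_div_cancel' hd']

end Colour

theorem IsCAC.sum_card_inter_le {n w : ℕ} {C : Finset (Finset (ZMod n))} (hC : IsCAC n w C)
    (A : Finset (Finset (ZMod n))) (hA : A ⊆ C) (R : Finset (ZMod n)) :
    ∑ x ∈ A, (differenceSet x ∩ R).card ≤ R.card := by
  rw [← Finset.card_biUnion]
  · refine Finset.card_le_card ?_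
    intro z hz
    obtain ⟨x, -, hx⟩ := Finset.mem_biUnion.1 hz
    exact (Finset.mem_inter.1 hx).2
  · intro x hx y hy hxy
    exact (hC.disjoint x (hA hx) y (hA hy) hxy).mono Finset.inter_subset_left
      Finset.inter_subset_left

theorem sub_mem_differenceSet {n : ℕ} {x : Finset (ZMod n)} {a b : ZMod n} (ha : a ∈ x)
    (hb : b ∈ x) (hab : a ≠ b) : a - b ∈ differenceSet x :=
  Finset.mem_image.2 ⟨(a, b), Finset.mem_offDiag.2 ⟨ha, hb, hab⟩, rfl⟩

theorem neg_mem_differenceSet {n : ℕ} {x : Finset (ZMod n)} {d : ZMod n}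
    (hd : d ∈ differenceSet x) : -d ∈ differenceSet x := by
  obtain ⟨⟨a, b⟩, hab, rfl⟩ := Finset.mem_image.1 hd
  obtain ⟨ha, hb, hne⟩ := Finset.mem_offDiag.1 hab
  rw [neg_sub]
  exact sub_mem_differenceSet hb ha hne.symm

theorem ne_zero_of_mem_differenceSet {n : ℕ} {x : Finset (ZMod n)} {d : ZMod n}
    (hd : d ∈ differenceSet x) : d ≠ 0 := by
  obtain ⟨⟨a, b⟩, hab, rfl⟩ := Finset.mem_image.1 hd
  exact sub_ne_zero.2 (Finset.mem_offDiag.1 hab).2.2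

theorem natCast_mul_ne_zero_of_prime_pow {p k m : ℕ} (hp : p.Prime) (hm : 0 < m) (hmp : m < p)
    {z : ZMod (p ^ k)} (hz : z ≠ 0) : (m : ZMod (p ^ k)) * z ≠ 0 := by
  have : IsUnit (m : ZMod (p ^ k)) :=
    (ZMod.isUnit_iff_coprime m (p ^ k)).2
      (Nat.Coprime.pow_right k (Nat.coprime_of_lt_prime hm.ne' hmp hp).symm)
  exact fun h => hz (this.mul_right_eq_zero.1 h)

section Upper

variable {p k : ℕ} [Fact p.Prime]

open Classical in
/-- The nonzero elements of level `v` and, if `o = some c`, of colour `(v, c)`. -/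
noncomputable def zmodRegion (p k e : ℕ) [Fact p.Prime] (κ : ℕ × Option (ZMod p)) :
    Finset (ZMod (p ^ k)) :=
  Finset.univ.filter fun z => z ≠ 0 ∧ zmodLevel p z = κ.1 ∧ ∀ c, κ.2 = some c → zmodResidue p z ^ e = c

theorem four_le_card_inter_zmodRegion (hp3 : 3 < p) {e : ℕ} (he : Even e)
    {x : Finset (ZMod (p ^ k))} {d d' : ZMod (p ^ k)} (hd : d ∈ differenceSet x)
    (hd' : d' ∈ differenceSet x) (h1 : d ≠ d') (h2 : d ≠ -d')
    (hc : zmodColour p e d = zmodColour p e d') :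
    4 ≤ (differenceSet x ∩ zmodRegion p k e (zmodLevel p d, some (zmodResidue p d ^ e))).card := by
  have hp := Fact.out (p := p.Prime)
  have hself : ∀ {z : ZMod (p ^ k)}, z ≠ 0 → z ≠ -z := by
    intro z hz h
    have := natCast_mul_ne_zero_of_prime_pow hp two_pos (by omega) hz
    exact this (by push_cast; linear_combination h)
  have d0 := ne_zero_of_mem_differenceSet hd
  have d0' := ne_zero_of_mem_differenceSet hd'
  have hcard : ({d, -d, d', -d'} : Finset (ZMod (p ^ k))).card = 4 := by
    have h3 : -d ≠ d' := fun h => h2 (by rw [← h, neg_neg])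
    have h4 : -d ≠ -d' := fun h => h1 (neg_injective h)
    rw [Finset.card_insert_of_notMem, Finset.card_insert_of_notMem, Finset.card_pair (hself d0')]
    · simp [h3, h1]
    · simp [h1, h2, hself d0]
  rw [← hcard]
  refine Finset.card_le_card ?_
  have key : ∀ z ∈ differenceSet x, zmodColour p e z = zmodColour p e d →
      z ∈ differenceSet x ∩ zmodRegion p k e (zmodLevel p d, some (zmodResidue p d ^ e)) := by
    intro z hz hzc
    rw [zmodColour, zmodColour, Prod.mk.injEq] at hzc
    simp only [zmodRegion, Finset.mem_inter, Finset.mem_filter, Finset.mem_univ, true_and,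
      Option.some.injEq]
    exact ⟨hz, ne_zero_of_mem_differenceSet hz, hzc.1, fun c h => h ▸ hzc.2⟩
  intro z hz
  simp only [Finset.mem_insert, Finset.mem_singleton] at hz
  rcases hz with rfl | rfl | rfl | rfl
  · exact key _ hd rfl
  · exact key _ (neg_mem_differenceSet hd) (zmodColour_neg he d0)
  · exact key _ hd' hc.symm
  · exact key _ (neg_mem_differenceSet hd') ((zmodColour_neg he d0').trans hc.symm)

theorem six_le_card_inter_zmodRegion (hp3 : 3 < p) {e : ℕ} (he : Even e)
    {x : Finset (ZMod (p ^ k))} {a b c : ZMod (p ^ k)} (ha : a ∈ differenceSet x)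
    (hb : b ∈ differenceSet x) (hc : c ∈ differenceSet x)
    (hab : zmodColour p e a ≠ zmodColour p e b) (hbc : zmodColour p e b ≠ zmodColour p e c)
    (hca : zmodColour p e c ≠ zmodColour p e a)
    (hab' : zmodLevel p a = zmodLevel p b) (hbc' : zmodLevel p b = zmodLevel p c) :
    6 ≤ (differenceSet x ∩ zmodRegion p k e (zmodLevel p a, none)).card := by
  have hp := Fact.out (p := p.Prime)
  have hself : ∀ {z : ZMod (p ^ k)}, z ≠ 0 → z ≠ -z := by
    intro z hz h
    have := natCast_mul_ne_zero_of_prime_pow hp two_pos (by omega) hz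
    exact this (by push_cast; linear_combination h)
  have a0 := ne_zero_of_mem_differenceSet ha
  have b0 := ne_zero_of_mem_differenceSet hb
  have c0 := ne_zero_of_mem_differenceSet hc
  have hne : ∀ {y z : ZMod (p ^ k)}, zmodColour p e y ≠ zmodColour p e z → y ≠ z :=
    fun h h' => h (congrArg _ h')
  have hcard : ({a, -a, b, -b, c, -c} : Finset (ZMod (p ^ k))).card = 6 := by
    have na := zmodColour_neg he a0
    have nb := zmodColour_neg he b0
    have nc := zmodColour_neg he c0
    rw [Finset.card_insert_of_notMem, Finset.card_insert_of_notMem, Finset.card_insert_of_notMem,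
      Finset.card_insert_of_notMem, Finset.card_pair (hself c0)]
    · simp only [Finset.mem_insert, Finset.mem_singleton, not_or]
      exact ⟨hne (by rwa [nb]), hne (by rwa [nb, nc])⟩
    · simp only [Finset.mem_insert, Finset.mem_singleton, not_or]
      exact ⟨hself b0, hne hbc, hne (by rwa [nc])⟩
    · simp only [Finset.mem_insert, Finset.mem_singleton, not_or]
      exact ⟨hne (by rwa [na]), hne (by rwa [na, nb]), hne (by rw [na]; exact hca.symm),
        hne (by rw [na, nc]; exact hca.symm)⟩
    · simp only [Finset.mem_insert, Finset.mem_singleton, not_or]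
      exact ⟨hself a0, hne hab, hne (by rwa [nb]), hne hca.symm, hne (by rw [nc]; exact hca.symm)⟩
  rw [← hcard]
  refine Finset.card_le_card ?_
  have hlev : ∀ {z : ZMod (p ^ k)}, z ≠ 0 → zmodLevel p (-z) = zmodLevel p z := fun hz =>
    (Prod.ext_iff.1 (zmodColour_neg he hz)).1
  have key : ∀ z ∈ differenceSet x, zmodLevel p z = zmodLevel p a →
      z ∈ differenceSet x ∩ zmodRegion p k e (zmodLevel p a, none) := by
    intro z hz hzc
    simp only [zmodRegion, Finset.mem_inter, Finset.mem_filter, Finset.mem_univ, true_and,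
      reduceCtorEq, false_imp_iff, implies_true, and_true]
    exact ⟨hz, ne_zero_of_mem_differenceSet hz, hzc⟩
  intro z hz
  simp only [Finset.mem_insert, Finset.mem_singleton] at hz
  rcases hz with rfl | rfl | rfl | rfl | rfl | rfl
  · exact key _ ha rfl
  · exact key _ (neg_mem_differenceSet ha) (hlev a0)
  · exact key _ hb hab'.symm
  · exact key _ (neg_mem_differenceSet hb) ((hlev b0).trans hab'.symm)
  · exact key _ hc (hab'.trans hbc').symm
  · exact key _ (neg_mem_differenceSet hc) ((hlev c0).trans (hab'.trans hbc').symm)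

/-- The number of elements a codeword occupies in its region. -/
def regionWeight {α : Type*} (o : Option α) : ℕ := if o.isSome then 4 else 6

theorem exists_region_of_card_eq_three (hp3 : 3 < p) {e ℓ : ℕ} (he : Even e) (he0 : e ≠ 0)
    (h2 : (2 : ZMod p) ^ e = 1) (hpe : p = e * ℓ + 1) {x : Finset (ZMod (p ^ k))}
    (hx : x.card = 3) :
    ∃ κ : ℕ × Option (ZMod p), κ.1 < k ∧ (∀ c, κ.2 = some c → c ^ ℓ = 1) ∧
      regionWeight κ.2 ≤ (differenceSet x ∩ zmodRegion p k e κ).card := by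
  have hp := Fact.out (p := p.Prime)
  obtain ⟨a, b, c, hab, hac, hbc, rfl⟩ := Finset.card_eq_three.1 hx
  set D := differenceSet ({a, b, c} : Finset (ZMod (p ^ k)))
  have four : ∀ {d d' : ZMod (p ^ k)}, d ∈ D → d' ∈ D → d ≠ d' → d ≠ -d' →
      zmodColour p e d = zmodColour p e d' →
      ∃ κ : ℕ × Option (ZMod p), κ.1 < k ∧ (∀ c, κ.2 = some c → c ^ ℓ = 1) ∧
      regionWeight κ.2 ≤ (D ∩ zmodRegion p k e κ).card := by
    intro d d' hd hd' h1 h2 h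
    have d0 := ne_zero_of_mem_differenceSet hd
    refine ⟨(zmodLevel p d, some (zmodResidue p d ^ e)), zmodLevel_lt d0, ?_,
      four_le_card_inter_zmodRegion hp3 he hd hd' h1 h2 h⟩
    rintro c hc
    rw [← Option.some.inj hc, ← pow_mul, show e * ℓ = p - 1 by omega]
    exact ZMod.pow_card_sub_one_eq_one (zmodResidue_ne_zero d0)
  have same : ∀ {d d' d'' : ZMod (p ^ k)}, d ∈ D → d' ∈ D → d'' ∈ D → d + d' + d'' = 0 →
      zmodColour p e d = zmodColour p e d' →
      ∃ κ : ℕ × Option (ZMod p), κ.1 < k ∧ (∀ c, κ.2 = some c → c ^ ℓ = 1) ∧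
      regionWeight κ.2 ≤ (D ∩ zmodRegion p k e κ).card := by
    intro d d' d'' hd hd' hd'' h hc
    have d0 := ne_zero_of_mem_differenceSet hd
    by_cases hdd : d = d'
    · subst hdd
      have e1 : d'' = -(2 * d) := by linear_combination h
      have h2d := natCast_mul_ne_zero_of_prime_pow hp two_pos (by omega) d0
      have h3d := natCast_mul_ne_zero_of_prime_pow hp three_pos (by omega) d0
      push_cast at h2d h3d
      refine four hd hd'' ?_ ?_ ?_
      · rw [e1]
        exact fun h => h3d (by linear_combination h)
      · rw [e1]
        exact fun h => d0 (by linear_combination -h)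
      · rw [e1, zmodColour_neg he h2d, zmodColour_two_mul he0 h2 d0]
    · refine four hd hd' hdd ?_ hc
      intro h'
      exact ne_zero_of_mem_differenceSet hd'' (by linear_combination h - h')
  have m1 : a - b ∈ D := sub_mem_differenceSet (by simp) (by simp) hab
  have m2 : b - c ∈ D := sub_mem_differenceSet (by simp) (by simp) hbc
  have m3 : c - a ∈ D := sub_mem_differenceSet (by simp) (by simp) hac.symm
  have n1 := ne_zero_of_mem_differenceSet m1
  have n2 := ne_zero_of_mem_differenceSet m2
  have n3 := ne_zero_of_mem_differenceSet m3
  by_cases c1 : zmodColour p e (a - b) = zmodColour p e (b - c)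
  · exact same m1 m2 m3 (by ring) c1
  by_cases c2 : zmodColour p e (b - c) = zmodColour p e (c - a)
  · exact same m2 m3 m1 (by ring) c2
  by_cases c3 : zmodColour p e (c - a) = zmodColour p e (a - b)
  · exact same m3 m1 m2 (by ring) c3
  obtain ⟨l1, l2⟩ := (((zmodColour_of_add_add_eq_zero he n1 n2 n3 (by ring)).resolve_left c1
    ).resolve_left c2).resolve_left c3
  exact ⟨(zmodLevel p (a - b), none), zmodLevel_lt n1, by simp,
    six_le_card_inter_zmodRegion hp3 he m1 m2 m3 c1 c2 c3 l1 l2⟩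

theorem card_zmodRegion_some_le {e : ℕ} (he0 : e ≠ 0) (v : ℕ) (c : ZMod p) :
    (zmodRegion p k e (v, some c)).card ≤ e * p ^ (k - 1 - v) := by
  classical
  calc _ ≤ _ := Finset.card_le_card ?_
    _ ≤ _ := card_level_residue_le v (Polynomial.nthRoots e c).toFinset
    _ ≤ e * p ^ (k - 1 - v) := Nat.mul_le_mul_right _
        ((Multiset.toFinset_card_le _).trans (Polynomial.card_nthRoots e c))
  intro z hz
  simp only [zmodRegion, Finset.mem_filter, Finset.mem_univ, true_and] at hz ⊢
  refine ⟨hz.1, hz.2.1, ?_⟩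
  rw [Multiset.mem_toFinset, Polynomial.mem_nthRoots (Nat.pos_of_ne_zero he0)]
  exact hz.2.2 c rfl

theorem card_zmodRegion_none_le {e : ℕ} (v : ℕ) :
    (zmodRegion p k e (v, none)).card ≤ (p - 1) * p ^ (k - 1 - v) := by
  classical
  calc _ ≤ _ := Finset.card_le_card ?_
    _ ≤ _ := card_level_residue_le v (Finset.univ.erase (0 : ZMod p))
    _ = (p - 1) * p ^ (k - 1 - v) := by
        rw [Finset.card_erase_of_mem (Finset.mem_univ _), Finset.card_univ, ZMod.card]
  intro z hz
  simp only [zmodRegion, Finset.mem_filter, Finset.mem_univ, true_and] at hz ⊢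
  exact ⟨hz.1, hz.2.1, by simpa using zmodResidue_ne_zero hz.1⟩

theorem IsCAC.card_le_of_prime_pow (hp3 : 3 < p) {n ℓ : ℕ} (hn : Odd n) (hℓ : Odd ℓ)
    (h2 : (2 : ZMod p) ^ (2 * n) = 1) (hpn : p = 2 * n * ℓ + 1)
    {C : Finset (Finset (ZMod (p ^ k)))} (hC : IsCAC (p ^ k) 3 C) :
    C.card ≤ ∑ v ∈ Finset.range k, (ℓ * ((p ^ (k - 1 - v) * n - 1) / 2) + ℓ / 3) := by
  classical
  have he0 : 2 * n ≠ 0 := by have := hn.pos; omega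
  have hex := fun x (hx : x ∈ C) =>
    exists_region_of_card_eq_three hp3 (even_two_mul n) he0 h2 hpn (hC.card_eq x hx)
  choose! F hF1 hF2 hF3 using hex
  have hC' : C.card = ∑ v ∈ Finset.range k, (C.filter fun x => (F x).1 = v).card :=
    Finset.card_eq_sum_card_fiberwise fun x hx => Finset.mem_coe.2 (Finset.mem_range.2 (hF1 x hx))
  rw [hC']
  refine Finset.sum_le_sum fun v _ => ?_
  obtain ⟨a, ha⟩ : Odd (p ^ (k - 1 - v) * n) := by
    refine Odd.mul (Odd.pow ?_) hn
    rw [hpn, mul_assoc]; exact odd_two_mul_add_one _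
  rw [ha, Nat.add_sub_cancel, Nat.mul_div_cancel_left _ two_pos]
  set A := C.filter fun x => (F x).1 = v with hA
  set P := A.filter fun x => (F x).2.isSome with hP
  set T := A.filter fun x => ¬ (F x).2.isSome with hT
  have hPT : P.card + T.card = A.card := Finset.card_filter_add_card_filter_not _
  have hAC : A ⊆ C := Finset.filter_subset _ _
  have hPA : P ⊆ A := Finset.filter_subset _ _
  have hTA : T ⊆ A := Finset.filter_subset _ _
  have htotal : 4 * P.card + 6 * T.card ≤ 2 * ((2 * a + 1) * ℓ) := by
    have h1 := hC.sum_card_inter_le A hAC (zmodRegion p k (2 * n) (v, none))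
    have h2 : ∑ x ∈ A, regionWeight (F x).2 ≤
        ∑ x ∈ A, (differenceSet x ∩ zmodRegion p k (2 * n) (v, none)).card := by
      refine Finset.sum_le_sum fun x hx => (hF3 x (hAC hx)).trans (Finset.card_le_card ?_)
      refine Finset.inter_subset_inter_left ?_
      intro z hz
      simp only [zmodRegion, Finset.mem_filter, Finset.mem_univ, true_and] at hz ⊢
      exact ⟨hz.1, hz.2.1.trans (Finset.mem_filter.1 hx).2, by simp⟩
    have h3 : ∑ x ∈ A, regionWeight (F x).2 = 4 * P.card + 6 * T.card := by
      simp only [regionWeight]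
      rw [Finset.sum_ite]
      simp only [Finset.sum_const, smul_eq_mul]
      rw [mul_comm, mul_comm _ 6]
    have h4 := card_zmodRegion_none_le (p := p) (k := k) (e := 2 * n) v
    have h5 : (p - 1) * p ^ (k - 1 - v) = 2 * ((2 * a + 1) * ℓ) := by
      rw [← ha, show p - 1 = 2 * n * ℓ by omega]; ring
    omega
  have hpair : P.card ≤ ℓ * a := by
    have hmap : ∀ x ∈ P, (F x).2 ∈ (Polynomial.nthRoots ℓ (1 : ZMod p)).toFinset.image some := by
      intro x hx
      obtain ⟨c, hc⟩ := Option.isSome_iff_exists.1 (Finset.mem_filter.1 hx).2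
      rw [hc]
      refine Finset.mem_image_of_mem _ ?_
      rw [Multiset.mem_toFinset, Polynomial.mem_nthRoots hℓ.pos]
      exact hF2 x (hAC (hPA hx)) c hc
    have hfib : ∀ o ∈ (Polynomial.nthRoots ℓ (1 : ZMod p)).toFinset.image some,
        (P.filter fun x => (F x).2 = o).card ≤ a := by
      intro o ho
      obtain ⟨c, -, rfl⟩ := Finset.mem_image.1 ho
      set G := P.filter fun x => (F x).2 = some c with hG
      have hGA : G ⊆ A := (Finset.filter_subset _ _).trans hPA
      have h1 := hC.sum_card_inter_le G (hGA.trans hAC) (zmodRegion p k (2 * n) (v, some c))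
      have h2 : ∑ x ∈ G, 4 ≤
          ∑ x ∈ G, (differenceSet x ∩ zmodRegion p k (2 * n) (v, some c)).card := by
        refine Finset.sum_le_sum fun x hx => ?_
        have e1 : F x = (v, some c) :=
          Prod.ext (Finset.mem_filter.1 (hGA hx)).2 (Finset.mem_filter.1 hx).2
        have e2 := hF3 x (hAC (hGA hx))
        rw [e1] at e2
        exact e2
      have h3 := card_zmodRegion_some_le (p := p) (k := k) he0 v c
      have h4 : 2 * n * p ^ (k - 1 - v) = 2 * (2 * a + 1) := by rw [← ha]; ring
      simp only [Finset.sum_const, smul_eq_mul] at h2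
      omega
    calc P.card ≤ a * ((Polynomial.nthRoots ℓ (1 : ZMod p)).toFinset.image some).card :=
          Finset.card_le_mul_card_image_of_maps_to hmap a hfib
      _ ≤ a * ℓ := Nat.mul_le_mul_left _ (Finset.card_image_le.trans
          ((Multiset.toFinset_card_le _).trans (Polynomial.card_nthRoots ℓ 1)))
      _ = ℓ * a := mul_comm _ _
  obtain ⟨m, hm⟩ := hℓ
  have h6 : (2 * a + 1) * ℓ = 2 * (ℓ * a) + ℓ := by ring
  omega

end Upper

/-- If `4` has order `n` modulo `p` and `p² ∤ 4 ^ n - 1`, then `4` has order `p ^ m * n` modulo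
`p ^ (m + 1)`. -/
theorem prime_pow_mul_dvd_of_dvd_four_pow_sub_one {p n m i : ℕ} [Fact p.Prime] (hp2 : p ≠ 2)
    (hn : orderOf (4 : ZMod p) = n) (hW : ¬ (p : ℤ) ^ 2 ∣ 4 ^ n - 1)
    (h : (p : ℤ) ^ (m + 1) ∣ 4 ^ i - 1) : p ^ m * n ∣ i := by
  have hp := Fact.out (p := p.Prime)
  have hcast : ∀ j, (p : ℤ) ∣ 4 ^ j - 1 ↔ (4 : ZMod p) ^ j = 1 := by
    intro j
    rw [← ZMod.intCast_zmod_eq_zero_iff_dvd]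
    push_cast
    exact sub_eq_zero
  have hi : n ∣ i := by
    rw [← hn]
    exact orderOf_dvd_of_pow_eq_one ((hcast i).1 ((dvd_pow_self _ m.succ_ne_zero).trans h))
  obtain ⟨j, rfl⟩ := hi
  rw [mul_comm]
  refine mul_dvd_mul_left _ ?_
  have h1 : (p : ℤ) ∣ 4 ^ n - 1 := (hcast n).2 (hn ▸ pow_orderOf_eq_one _)
  have h4 : ¬ (p : ℤ) ∣ 4 ^ n := fun h' => by
    have := (dvd_sub_right h').1 h1
    exact hp.one_lt.ne' (by exact_mod_cast Int.eq_one_of_dvd_one (by positivity) this)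
  have hlte := Int.emultiplicity_pow_sub_pow (p := p) hp (hp.odd_of_ne_two hp2) h1 h4 j
  rw [one_pow, ← pow_mul] at hlte
  have hlt : emultiplicity (p : ℤ) (4 ^ n - 1) < 2 := emultiplicity_lt_iff_not_dvd.2 hW
  have hle : emultiplicity (p : ℤ) (4 ^ n - 1) ≤ 1 := Order.le_of_lt_add_one (by
    rwa [one_add_one_eq_two])
  rw [pow_dvd_iff_le_emultiplicity, hlte] at h
  rw [pow_dvd_iff_le_emultiplicity]
  have h5 : (1 : ℕ∞) + m ≤ 1 + emultiplicity p j := by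
    refine le_trans ?_ (h.trans (by gcongr))
    push_cast
    rw [add_comm]
  exact (ENat.add_le_add_iff_left ENat.one_ne_top).1 h5

/-- Representatives of the `ℓ` cosets of `{x | x ^ (2n) = 1}` in the units modulo `p`, consecutive
triples of which have sum zero. -/
theorem exists_coset_representatives {p n ℓ : ℕ} [Fact p.Prime]
    (hpn : p = 2 * n * ℓ + 1) (hn : Odd n) (hℓ : ℓ.Prime) (hodd : Odd ℓ)
    (h2 : (2 : ZMod p) ^ (2 * n) = 1) :
    ∃ a : ℕ → ℤ, (∀ j, (a j : ZMod p) ≠ 0) ∧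
      (∀ j < ℓ, ∀ j' < ℓ, (a j : ZMod p) ^ (2 * n) = (a j' : ZMod p) ^ (2 * n) → j = j') ∧
      ∀ q, a (3 * q) + a (3 * q + 1) + a (3 * q + 2) = 0 := by
  have hn0 := hn.pos
  have h2n : 2 * n ≠ 0 := by omega
  have h3 : 3 ≤ ℓ := by
    obtain ⟨m, hm⟩ := hodd
    have := hℓ.two_le
    omega
  obtain ⟨t, ht1, ht⟩ := exists_pow_ne_one_mul_add_one_pow_eq_one hpn hn hodd h3 h2
  have htt : t * (t + 1) ≠ 0 := by
    intro h
    rw [h, zero_pow h2n] at ht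
    exact zero_ne_one ht
  have ht0 := left_ne_zero_of_mul htt
  have hw0 := right_ne_zero_of_mul htt
  set T : ℤ := (t.val : ℤ) with hT
  have hTt : (T : ZMod p) = t := by simp [hT]
  set ω := (t + 1) ^ (2 * n) with hω
  have hTω : t ^ (2 * n) * ω = 1 := by rw [← mul_pow, ht]
  have hω1 : ω ≠ 1 := by
    intro h
    rw [h, mul_one] at hTω
    exact ht1 hTω
  have hωℓ : ω ^ ℓ = 1 := by
    rw [hω, ← pow_mul, show 2 * n * ℓ = p - 1 by omega]
    exact ZMod.pow_card_sub_one_eq_one hw0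
  have := Fact.mk hℓ
  have hord : orderOf ω = ℓ := orderOf_eq_prime hωℓ hω1
  have hωne : ω ≠ 0 := pow_ne_zero _ hw0
  let a : ℕ → ℤ := fun j =>
    (T + 1) ^ (3 * (j / 3)) * (if j % 3 = 0 then T else if j % 3 = 1 then 1 else -(T + 1))
  have a0 : ∀ q, a (3 * q) = (T + 1) ^ (3 * q) * T := by
    intro q
    simp only [a]
    rw [show 3 * q / 3 = q by omega, if_pos (by omega)]
  have a1 : ∀ q, a (3 * q + 1) = (T + 1) ^ (3 * q) := by
    intro q
    simp only [a]
    rw [show (3 * q + 1) / 3 = q by omega, if_neg (by omega), if_pos (by omega), mul_one]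
  have a2 : ∀ q, a (3 * q + 2) = -((T + 1) ^ (3 * q) * (T + 1)) := by
    intro q
    simp only [a]
    rw [show (3 * q + 2) / 3 = q by omega, if_neg (by omega), if_neg (by omega), mul_neg]
  have hcases : ∀ j : ℕ, ∃ q, j = 3 * q ∨ j = 3 * q + 1 ∨ j = 3 * q + 2 := fun j =>
    ⟨j / 3, by omega⟩
  have hpow : ∀ j, (a j : ZMod p) ^ (2 * n) * ω = ω ^ j := by
    intro j
    have hpq : ∀ q, ((t + 1) ^ q) ^ (2 * n) = ω ^ q := fun q => by
      rw [hω, ← pow_mul, ← pow_mul, mul_comm]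
    obtain ⟨q, rfl | rfl | rfl⟩ := hcases j
    · rw [a0]
      push_cast
      rw [hTt, mul_pow, mul_assoc, hTω, mul_one, hpq]
    · rw [a1]
      push_cast
      rw [hTt, hpq, pow_succ]
    · rw [a2]
      push_cast
      rw [hTt, (even_two_mul n).neg_pow, mul_pow, hpq, ← hω, pow_succ, pow_succ]
  refine ⟨a, ?_, ?_, ?_⟩
  · intro j h
    have := hpow j
    rw [h, zero_pow h2n, zero_mul] at this
    exact pow_ne_zero j hωne this.symm
  · intro j hj j' hj' h
    have h' : ω ^ j = ω ^ j' := by rw [← hpow, ← hpow, h]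
    exact pow_injOn_Iio_orderOf (by simpa [hord] using hj) (by simpa [hord] using hj') h'
  · intro q
    rw [a0, a1, a2]
    ring

theorem pow_dvd_sub_of_intCast_eq {p k v : ℕ} (hp : p.Prime) (hv : v < k) {a x y : ℤ}
    (ha : (a : ZMod p) ≠ 0)
    (h : (((p : ℤ) ^ v * (a * x) : ℤ) : ZMod (p ^ k)) = (((p : ℤ) ^ v * (a * y) : ℤ) : ZMod (p ^ k))) :
    (p : ℤ) ^ (k - 1 - v + 1) ∣ x - y := by
  rw [eq_comm, ZMod.intCast_eq_intCast_iff_dvd_sub] at h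
  have e1 : ((p ^ k : ℕ) : ℤ) = (p : ℤ) ^ v * (p : ℤ) ^ (k - 1 - v + 1) := by
    rw [← pow_add, show v + (k - 1 - v + 1) = k by omega]; push_cast; rfl
  have hpv : (p : ℤ) ^ v ≠ 0 := pow_ne_zero _ (by exact_mod_cast hp.ne_zero)
  rw [e1, ← mul_sub, ← mul_sub, mul_dvd_mul_iff_left hpv] at h
  refine IsCoprime.dvd_of_dvd_mul_left (IsCoprime.pow_left ?_) h
  rw [Prime.coprime_iff_not_dvd (Nat.prime_iff_prime_int.1 hp)]
  rwa [← ZMod.intCast_zmod_eq_zero_iff_dvd]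

/-- The points `p ^ v * a j * 2 ^ i` are distinct up to sign. -/
theorem zmod_points_injective {p n ℓ k : ℕ} [Fact p.Prime] (hp2 : p ≠ 2)
    (hn : orderOf (4 : ZMod p) = n) (hW : ¬ (p : ℤ) ^ 2 ∣ 4 ^ n - 1) {a : ℕ → ℤ}
    (h2 : (2 : ZMod p) ^ (2 * n) = 1) (ha0 : ∀ j, (a j : ZMod p) ≠ 0)
    (ha : ∀ j < ℓ, ∀ j' < ℓ, (a j : ZMod p) ^ (2 * n) = (a j' : ZMod p) ^ (2 * n) → j = j')
    {v j i v' j' i' : ℕ} (hv : v < k) (hj : j < ℓ) (hi : i < p ^ (k - 1 - v) * n)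
    (hv' : v' < k) (hj' : j' < ℓ) (hi' : i' < p ^ (k - 1 - v') * n)
    (h : (((p : ℤ) ^ v * (a j * 2 ^ i) : ℤ) : ZMod (p ^ k)) =
        (((p : ℤ) ^ v' * (a j' * 2 ^ i') : ℤ) : ZMod (p ^ k)) ∨
      (((p : ℤ) ^ v * (a j * 2 ^ i) : ℤ) : ZMod (p ^ k)) =
        -(((p : ℤ) ^ v' * (a j' * 2 ^ i') : ℤ) : ZMod (p ^ k))) :
    v = v' ∧ j = j' ∧ i = i' := by
  have hp := Fact.out (p := p.Prime)
  have h20 : (2 : ZMod p) ≠ 0 := by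
    intro h'
    have : (2 : ZMod p) = ((2 : ℕ) : ZMod p) := by norm_num
    rw [this, ZMod.natCast_eq_zero_iff] at h'
    exact hp2 ((Nat.prime_dvd_prime_iff_eq hp Nat.prime_two).1 h')
  obtain ⟨s, hs, h⟩ : ∃ s : ℤ, (s = 1 ∨ s = -1) ∧ (((p : ℤ) ^ v * (a j * 2 ^ i) : ℤ) : ZMod (p ^ k)) =
        (((p : ℤ) ^ v' * (a j' * (s * 2 ^ i')) : ℤ) : ZMod (p ^ k)) := by
    rcases h with h | h
    · exact ⟨1, Or.inl rfl, by rw [h, one_mul]⟩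
    · exact ⟨-1, Or.inr rfl, by rw [h]; push_cast; ring⟩
  have hss : s ^ 2 = 1 := by rcases hs with rfl | rfl <;> norm_num
  have hsp : (s : ZMod p) ^ 2 = 1 := by rw [← Int.cast_pow, hss, Int.cast_one]
  have hs0 : (s : ZMod p) ≠ 0 := by
    intro h0
    rw [h0] at hsp
    norm_num at hsp
  have hpw : ∀ i, ((2 : ZMod p) ^ i) ^ (2 * n) = 1 := fun i => by
    rw [← pow_mul, mul_comm, pow_mul, h2, one_pow]
  have hcol := congrArg (zmodColour p (2 * n)) h
  rw [zmodColour_eq _ hv (by push_cast; exact mul_ne_zero (ha0 j) (pow_ne_zero _ h20)),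
    zmodColour_eq _ hv' (by
      push_cast; exact mul_ne_zero (ha0 j') (mul_ne_zero hs0 (pow_ne_zero _ h20))),
    Prod.mk.injEq] at hcol
  obtain ⟨rfl, hc⟩ := hcol
  push_cast at hc
  rw [mul_pow, mul_pow, mul_pow, hpw, hpw, pow_mul (s : ZMod p), hsp, one_pow, mul_one, mul_one,
    mul_one] at hc
  obtain rfl := ha j hj j' hj' hc
  refine ⟨rfl, rfl, ?_⟩
  have hd := pow_dvd_sub_of_intCast_eq hp hv (ha0 j) h
  have hd4 : (p : ℤ) ^ (k - 1 - v + 1) ∣ 4 ^ i - 4 ^ i' := by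
    have : (4 : ℤ) ^ i - 4 ^ i' = (2 ^ i - s * 2 ^ i') * (2 ^ i + s * 2 ^ i') := by
      have e : ∀ m : ℕ, (4 : ℤ) ^ m = (2 ^ m) ^ 2 := fun m => by
        rw [← pow_mul, mul_comm, pow_mul]; norm_num
      rw [e, e]
      linear_combination (2 ^ i') ^ 2 * hss
    rw [this]
    exact Dvd.dvd.mul_right hd _
  have main : ∀ {i i' : ℕ}, i ≤ i' → i' < p ^ (k - 1 - v) * n →
      (p : ℤ) ^ (k - 1 - v + 1) ∣ 4 ^ i - 4 ^ i' → i = i' := by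
    intro i i' hle hlt hd
    obtain ⟨d, rfl⟩ := Nat.exists_eq_add_of_le hle
    have e : (4 : ℤ) ^ i - 4 ^ (i + d) = -(4 ^ i * (4 ^ d - 1)) := by ring
    rw [e, dvd_neg] at hd
    have hcop : IsCoprime ((p : ℤ) ^ (k - 1 - v + 1)) (4 ^ i) := by
      refine IsCoprime.pow ?_
      rw [Prime.coprime_iff_not_dvd (Nat.prime_iff_prime_int.1 hp),
        ← ZMod.intCast_zmod_eq_zero_iff_dvd]
      have : ((4 : ℤ) : ZMod p) = 2 * 2 := by norm_num
      rw [this]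
      exact mul_ne_zero h20 h20
    have := Nat.eq_zero_of_dvd_of_lt (prime_pow_mul_dvd_of_dvd_four_pow_sub_one hp2 hn hW
      (hcop.dvd_of_dvd_mul_left hd)) (by omega)
    omega
  rcases le_total i i' with hle | hle
  · exact main hle hi' hd4
  · exact (main hle hi (by rw [← dvd_neg, neg_sub]; exact hd4)).symm

theorem mem_differenceSet_zero_insert_neg {N : ℕ} {x y d : ZMod N}
    (hd : d ∈ differenceSet ({0, x, -y} : Finset (ZMod N))) :
    ∃ z, (z = x ∨ z = y ∨ z = x + y) ∧ (d = z ∨ d = -z) := by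
  obtain ⟨⟨a, b⟩, hab, rfl⟩ := Finset.mem_image.1 hd
  obtain ⟨ha, hb, hne⟩ := Finset.mem_offDiag.1 hab
  simp only [Finset.mem_insert, Finset.mem_singleton] at ha hb hne
  rcases ha with rfl | rfl | rfl <;> rcases hb with rfl | rfl | rfl
  · exact absurd rfl hne
  · exact ⟨b, by simp, by simp⟩
  · exact ⟨y, by simp, by simp⟩
  · exact ⟨a, by simp, by simp⟩
  · exact absurd rfl hne
  · exact ⟨a + y, by simp, by simp⟩
  · exact ⟨y, by simp, by simp⟩
  · exact ⟨b + y, by simp, Or.inr (by ring)⟩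
  · exact absurd rfl hne

/-- A family of words `{0, f i, -g i}` whose differences are, up to sign, points with pairwise
disjoint sets of labels is a conflict-avoiding code of weight three. -/
theorem exists_isCAC_three_of_labels {N : ℕ} {ι Λ : Type*} (s : Finset ι) (f g : ι → ZMod N)
    (lab : ι → Set Λ) (V : Set Λ) (pt : Λ → ZMod N)
    (hV : ∀ i ∈ s, lab i ⊆ V)
    (hpt0 : ∀ l ∈ V, pt l ≠ 0)
    (hpt : ∀ l ∈ V, ∀ l' ∈ V, pt l = pt l' ∨ pt l = -pt l' → l = l')
    (hlab : ∀ i ∈ s, ∀ z, (z = f i ∨ z = g i ∨ z = f i + g i) →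
      ∃ l ∈ lab i, z = pt l ∨ z = -pt l)
    (hdisj : ∀ i ∈ s, ∀ j ∈ s, ∀ l ∈ lab i, l ∈ lab j → i = j) :
    ∃ C : Finset (Finset (ZMod N)), IsCAC N 3 C ∧ C.card = s.card := by
  classical
  let word : ι → Finset (ZMod N) := fun i => {0, f i, -g i}
  have hmem : ∀ i ∈ s, ∀ d ∈ differenceSet (word i), ∃ l ∈ lab i, d = pt l ∨ d = -pt l := by
    intro i hi d hd
    obtain ⟨z, hz, hdz⟩ := mem_differenceSet_zero_insert_neg hd
    obtain ⟨l, hl, hzl⟩ := hlab i hi z hz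
    refine ⟨l, hl, ?_⟩
    rcases hdz with rfl | rfl <;> rcases hzl with rfl | rfl <;> simp
  have hdis : ∀ i ∈ s, ∀ j ∈ s, ∀ d ∈ differenceSet (word i), d ∈ differenceSet (word j) →
      i = j := by
    intro i hi j hj d hdi hdj
    obtain ⟨l, hl, hl'⟩ := hmem i hi d hdi
    obtain ⟨m, hm, hm'⟩ := hmem j hj d hdj
    have : l = m := by
      refine hpt l (hV i hi hl) m (hV j hj hm) ?_
      rcases hl' with rfl | rfl <;> rcases hm' with h | h
      · exact Or.inl h
      · exact Or.inr h
      · exact Or.inr (neg_eq_iff_eq_neg.1 h)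
      · exact Or.inl (neg_injective h)
    exact hdisj i hi j hj l hl (this ▸ hm)
  have hz0 : ∀ i ∈ s, ∀ z, (z = f i ∨ z = g i ∨ z = f i + g i) → z ≠ 0 := by
    intro i hi z hz
    obtain ⟨l, hl, rfl | rfl⟩ := hlab i hi z hz
    · exact hpt0 l (hV i hi hl)
    · exact neg_ne_zero.2 (hpt0 l (hV i hi hl))
  have hword : ∀ i ∈ s, f i ≠ 0 ∧ g i ≠ 0 ∧ f i + g i ≠ 0 := fun i hi =>
    ⟨hz0 i hi _ (by simp), hz0 i hi _ (by simp), hz0 i hi _ (by simp)⟩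
  have hdiff : ∀ i ∈ s, f i ∈ differenceSet (word i) := by
    intro i hi
    have := sub_mem_differenceSet (x := word i) (a := f i) (b := 0) (by simp [word])
      (by simp [word]) (hword i hi).1
    rwa [sub_zero] at this
  refine ⟨s.image word, ⟨?_, ?_⟩, Finset.card_image_of_injOn ?_⟩
  · intro x hx
    obtain ⟨i, hi, rfl⟩ := Finset.mem_image.1 hx
    obtain ⟨h1, h2, h3⟩ := hword i hi
    refine Finset.card_eq_three.2 ⟨0, f i, -g i, h1.symm, (neg_ne_zero.2 h2).symm, ?_, rfl⟩
    exact fun h => h3 (by rw [h]; ring)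
  · intro x hx y hy hxy
    obtain ⟨i, hi, rfl⟩ := Finset.mem_image.1 hx
    obtain ⟨j, hj, rfl⟩ := Finset.mem_image.1 hy
    exact Finset.disjoint_left.2 fun d hd hd' =>
      hxy (congrArg word (hdis i hi j hj d hd hd'))
  · intro i hi j hj h
    exact hdis i hi j hj (f i) (hdiff i hi) (h ▸ hdiff i hi)

theorem exists_isCAC_of_prime_pow {p n ℓ : ℕ} [Fact p.Prime] (hp2 : p ≠ 2)
    (hn : orderOf (4 : ZMod p) = n) (hW : ¬ (p : ℤ) ^ 2 ∣ 4 ^ n - 1) (hn' : Odd n)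
    (hℓ : ℓ.Prime) (hodd : Odd ℓ) (hpn : p = 2 * n * ℓ + 1)
    (h2 : (2 : ZMod p) ^ (2 * n) = 1) (k : ℕ) :
    ∃ C : Finset (Finset (ZMod (p ^ k))), IsCAC (p ^ k) 3 C ∧
      C.card = ∑ v ∈ Finset.range k, (ℓ * ((p ^ (k - 1 - v) * n - 1) / 2) + ℓ / 3) := by
  have hp := Fact.out (p := p.Prime)
  obtain ⟨a, ha0, ha, hsum⟩ := exists_coset_representatives hpn hn' hℓ hodd h2
  have h20 : (2 : ZMod p) ≠ 0 := by
    intro h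
    rw [h, zero_pow (by have := hn'.pos; omega)] at h2
    exact zero_ne_one h2
  have hcard : (∑ v ∈ Finset.range k, (ℓ * ((p ^ (k - 1 - v) * n - 1) / 2) + ℓ / 3)) =
      ((Finset.range k).sigma fun v => (Finset.range ℓ ×ˢ
        Finset.range ((p ^ (k - 1 - v) * n - 1) / 2)).disjSum (Finset.range (ℓ / 3))).card := by
    simp [Finset.card_sigma, Finset.card_disjSum]
  rw [hcard]
  let pt : ℕ × ℕ × ℕ → ZMod (p ^ k) := fun l => (((p : ℤ) ^ l.1 * (a l.2.1 * 2 ^ l.2.2) : ℤ) : ZMod _)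
  let f : (Σ _ : ℕ, (ℕ × ℕ) ⊕ ℕ) → ZMod (p ^ k) := fun x => match x with
    | ⟨v, Sum.inl (j, i)⟩ => pt (v, j, 2 * i + 1)
    | ⟨v, Sum.inr q⟩ => pt (v, 3 * q, 0)
  let g : (Σ _ : ℕ, (ℕ × ℕ) ⊕ ℕ) → ZMod (p ^ k) := fun x => match x with
    | ⟨v, Sum.inl (j, i)⟩ => pt (v, j, 2 * i + 1)
    | ⟨v, Sum.inr q⟩ => pt (v, 3 * q + 1, 0)
  let lab : (Σ _ : ℕ, (ℕ × ℕ) ⊕ ℕ) → Set (ℕ × ℕ × ℕ) := fun x => match x with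
    | ⟨v, Sum.inl (j, i)⟩ => {(v, j, 2 * i + 1), (v, j, 2 * i + 2)}
    | ⟨v, Sum.inr q⟩ => {(v, 3 * q, 0), (v, 3 * q + 1, 0), (v, 3 * q + 2, 0)}
  refine exists_isCAC_three_of_labels _ f g lab
    {l | l.1 < k ∧ l.2.1 < ℓ ∧ l.2.2 < p ^ (k - 1 - l.1) * n} pt ?_ ?_ ?_ ?_ ?_
  · rintro ⟨v, ⟨j, i⟩ | q⟩ hx l hl
    · simp only [Finset.mem_sigma, Finset.mem_range, Finset.inl_mem_disjSum,
        Finset.mem_product] at hx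
      simp only [lab, Set.mem_insert_iff, Set.mem_singleton_iff] at hl
      rcases hl with rfl | rfl
      · exact ⟨hx.1, hx.2.1, by dsimp only; omega⟩
      · exact ⟨hx.1, hx.2.1, by dsimp only; omega⟩
    · simp only [Finset.mem_sigma, Finset.mem_range, Finset.inr_mem_disjSum] at hx
      have hpos : 0 < p ^ (k - 1 - v) * n := Nat.mul_pos (pow_pos hp.pos _) hn'.pos
      simp only [lab, Set.mem_insert_iff, Set.mem_singleton_iff] at hl
      rcases hl with rfl | rfl | rfl
      · exact ⟨hx.1, by dsimp only; omega, hpos⟩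
      · exact ⟨hx.1, by dsimp only; omega, hpos⟩
      · exact ⟨hx.1, by dsimp only; omega, hpos⟩
  · rintro ⟨v, j, i⟩ ⟨hv, -, -⟩ h
    have h' : (((p : ℤ) ^ v * (a j * 2 ^ i) : ℤ) : ZMod (p ^ k)) =
        (((p : ℤ) ^ v * (a j * 0) : ℤ) : ZMod (p ^ k)) := by
      rw [mul_zero, mul_zero, Int.cast_zero]
      exact h
    have hd := (dvd_pow_self (p : ℤ) (Nat.succ_ne_zero _)).trans
      (pow_dvd_sub_of_intCast_eq hp hv (ha0 j) h')
    rw [sub_zero, ← ZMod.intCast_zmod_eq_zero_iff_dvd] at hd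
    push_cast at hd
    exact pow_ne_zero _ h20 hd
  · rintro ⟨v, j, i⟩ ⟨hv, hj, hi⟩ ⟨v', j', i'⟩ ⟨hv', hj', hi'⟩ h
    obtain ⟨rfl, rfl, rfl⟩ :=
      zmod_points_injective hp2 hn hW h2 ha0 ha hv hj hi hv' hj' hi' h
    rfl
  · rintro ⟨v, ⟨j, i⟩ | q⟩ - z hz
    · rcases hz with rfl | rfl | rfl
      · exact ⟨(v, j, 2 * i + 1), by simp [lab], Or.inl rfl⟩
      · exact ⟨(v, j, 2 * i + 1), by simp [lab], Or.inl rfl⟩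
      · refine ⟨(v, j, 2 * i + 2), by simp [lab], Or.inl ?_⟩
        simp only [f, g, pt]
        push_cast
        ring
    · rcases hz with rfl | rfl | rfl
      · exact ⟨(v, 3 * q, 0), by simp [lab], Or.inl rfl⟩
      · exact ⟨(v, 3 * q + 1, 0), by simp [lab], Or.inl rfl⟩
      · refine ⟨(v, 3 * q + 2, 0), by simp [lab], Or.inr ?_⟩
        have := congrArg (fun m : ℤ => (m : ZMod (p ^ k))) (hsum q)
        simp only [f, g, pt]
        push_cast at this ⊢
        linear_combination (p : ZMod (p ^ k)) ^ v * this
  · rintro ⟨v, ⟨j, i⟩ | q⟩ - ⟨v', ⟨j', i'⟩ | q'⟩ - l hl hl' <;>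
      simp only [lab, Set.mem_insert_iff, Set.mem_singleton_iff] at hl hl'
    · have : v = v' ∧ j = j' ∧ i = i' := by
        rcases hl with rfl | rfl <;> simp only [Prod.mk.injEq] at hl' <;> omega
      obtain ⟨rfl, rfl, rfl⟩ := this
      rfl
    · exfalso
      rcases hl with rfl | rfl <;> simp only [Prod.mk.injEq] at hl' <;> omega
    · exfalso
      rcases hl with rfl | rfl | rfl <;> simp only [Prod.mk.injEq] at hl' <;> omega
    · have : v = v' ∧ q = q' := by
        rcases hl with rfl | rfl | rfl <;> simp only [Prod.mk.injEq] at hl' <;> omega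
      obtain ⟨rfl, rfl⟩ := this
      rfl

theorem odd_orderOf_four {p : ℕ} [Fact p.Prime] (hp2 : p ≠ 2)
    (hord : ¬ 4 ∣ orderOf (2 : ZMod p)) : Odd (orderOf (4 : ZMod p)) := by
  have hp := Fact.out (p := p.Prime)
  have h20 : (2 : ZMod p) ≠ 0 := by
    intro h
    have h' : ((2 : ℕ) : ZMod p) = 0 := by exact_mod_cast h
    rw [ZMod.natCast_eq_zero_iff] at h'
    exact hp2 ((Nat.prime_dvd_prime_iff_eq hp Nat.prime_two).1 h')
  have hpos : orderOf (2 : ZMod p) ≠ 0 := by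
    refine (orderOf_pos_iff.2 (isOfFinOrder_iff_pow_eq_one.2 ⟨p - 1, ?_, ?_⟩)).ne'
    · have := hp.two_le; omega
    · exact ZMod.pow_card_sub_one_eq_one h20
  rw [show (4 : ZMod p) = 2 ^ 2 by norm_num, orderOf_pow' _ two_ne_zero]
  rcases Nat.even_or_odd (orderOf (2 : ZMod p)) with h | h
  · obtain ⟨m, hm⟩ := h
    rw [hm, ← two_mul, Nat.gcd_eq_right (dvd_mul_right 2 m), Nat.mul_div_cancel_left _ two_pos]
    by_contra hm'
    obtain ⟨r, hr⟩ := Nat.not_odd_iff_even.1 hm'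
    exact hord ⟨r, by omega⟩
  · rw [Nat.Coprime.gcd_eq_one (Nat.coprime_two_right.2 h), Nat.div_one]
    exact h

theorem card_subgroupNegOneTwo {p : ℕ} [Fact p.Prime] (hp2 : p ≠ 2)
    (hodd : Odd (orderOf (4 : ZMod p))) :
    Nat.card (subgroupNegOneTwo p) = 2 * orderOf (4 : ZMod p) := by
  have hp := Fact.out (p := p.Prime)
  have h20 : (2 : ZMod p) ≠ 0 := by
    intro h
    have h' : ((2 : ℕ) : ZMod p) = 0 := by exact_mod_cast h
    rw [ZMod.natCast_eq_zero_iff] at h'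
    exact hp2 ((Nat.prime_dvd_prime_iff_eq hp Nat.prime_two).1 h')
  set n := orderOf (4 : ZMod p) with hn
  have h2n : 2 * n ≠ 0 := by have := hodd.pos; omega
  apply le_antisymm
  · have : NeZero (2 * n) := ⟨h2n⟩
    have hle : subgroupNegOneTwo p ≤ rootsOfUnity (2 * n) (ZMod p) := by
      refine (Subgroup.closure_le _).2 ?_
      rintro u (hu | hu)
      · rw [SetLike.mem_coe, mem_rootsOfUnity', hu]
        exact (even_two_mul n).neg_one_pow
      · rw [SetLike.mem_coe, mem_rootsOfUnity', hu, pow_mul, show (2 : ZMod p) ^ 2 = 4 by norm_num]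
        exact pow_orderOf_eq_one _
    calc Nat.card (subgroupNegOneTwo p) ≤ Nat.card (rootsOfUnity (2 * n) (ZMod p)) :=
          Subgroup.card_le_of_le hle
      _ ≤ 2 * n := card_rootsOfUnity _ _
  · have hp' : Fact (2 < p) := ⟨lt_of_le_of_ne hp.two_le hp2.symm⟩
    have hu : Units.mk0 (2 : ZMod p) h20 ∈ subgroupNegOneTwo p :=
      Subgroup.subset_closure (Or.inr rfl)
    have hm : (-1 : (ZMod p)ˣ) ∈ subgroupNegOneTwo p :=
      Subgroup.subset_closure (Or.inl (by simp))
    have d1 : 2 ∣ Nat.card (subgroupNegOneTwo p) := by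
      have := Subgroup.orderOf_dvd_natCard _ hm
      rwa [← orderOf_units, Units.val_neg, Units.val_one, orderOf_neg_one, ZMod.ringChar_zmod_n,
        if_neg hp2] at this
    have d2 : n ∣ Nat.card (subgroupNegOneTwo p) := by
      have := Subgroup.orderOf_dvd_natCard _ (Subgroup.pow_mem _ hu 2)
      rwa [← orderOf_units, Units.val_pow_eq_pow_val, Units.val_mk0,
        show (2 : ZMod p) ^ 2 = 4 by norm_num] at this
    exact Nat.le_of_dvd Nat.card_pos
      (Nat.Coprime.mul_dvd_of_dvd_of_dvd (Nat.coprime_two_left.2 hodd) d1 d2)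

theorem sum_level_card_eq {p n ℓ : ℕ} (hpn : p = 2 * n * ℓ + 1) (hn : Odd n) (k : ℕ) :
    ((∑ v ∈ Finset.range k, (ℓ * ((p ^ (k - 1 - v) * n - 1) / 2) + ℓ / 3) : ℕ) : ℚ) =
      ((p : ℚ) ^ k - 1 - 2 * (k : ℚ) * (ℓ : ℚ)) / 4 + (k : ℚ) * (⌊(ℓ : ℚ) / 3⌋ : ℚ) := by
  have hfloor : (⌊(ℓ : ℚ) / 3⌋ : ℚ) = ((ℓ / 3 : ℕ) : ℚ) := by
    have := Rat.floor_natCast_div_natCast ℓ 3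
    push_cast at this
    rw [this]
    norm_cast
  have hterm : ∀ v ∈ Finset.range k,
      ((ℓ * ((p ^ (k - 1 - v) * n - 1) / 2) + ℓ / 3 : ℕ) : ℚ) =
        ((p : ℚ) - 1) / 4 * (p : ℚ) ^ (k - 1 - v) + (((ℓ / 3 : ℕ) : ℚ) - ℓ / 2) := by
    intro v _
    obtain ⟨a, ha⟩ : Odd (p ^ (k - 1 - v) * n) := by
      refine Odd.mul (Odd.pow ?_) hn
      rw [hpn, mul_assoc]; exact odd_two_mul_add_one _
    have ha' : (p : ℚ) ^ (k - 1 - v) * n = 2 * a + 1 := by exact_mod_cast ha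
    have hp1 : (p : ℚ) - 1 = 2 * n * ℓ := by rw [hpn]; push_cast; ring
    rw [ha, Nat.add_sub_cancel, Nat.mul_div_cancel_left _ two_pos, hp1]
    push_cast
    linear_combination (-(ℓ : ℚ) / 2) * ha'
  rw [Nat.cast_sum, Finset.sum_congr rfl hterm, Finset.sum_add_distrib, ← Finset.mul_sum,
    Finset.sum_range_reflect (fun v => (p : ℚ) ^ v) k, hfloor, Finset.sum_const, Finset.card_range,
    nsmul_eq_mul]
  linear_combination (1 / 4 : ℚ) * mul_geom_sum (p : ℚ) k

theorem corollary4p2 (p : ℕ) (hp : p.Prime) (hp3 : 3 < p)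
    (hW : ¬ 2 ^ (p - 1) ≡ 1 [MOD p ^ 2])
    (hord : ¬ 4 ∣ orderOf (2 : ZMod p))
    (ℓ : ℕ) (hindex : ℓ = (subgroupNegOneTwo p).index)
    (hprime : ℓ.Prime) (hodd : Odd ℓ)
    (k : ℕ) (hk : 1 ≤ k) :
    (∃ C : Finset (Finset (ZMod (p ^ k))), IsOptimalCAC (p ^ k) 3 C) ∧
    ∀ C : Finset (Finset (ZMod (p ^ k))), IsOptimalCAC (p ^ k) 3 C →
      (C.card : ℚ) = ((p : ℚ) ^ k - 1 - 2 * (k : ℚ) * (ℓ : ℚ)) / 4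
        + (k : ℚ) * (⌊(ℓ : ℚ) / 3⌋ : ℚ) := by
  have := Fact.mk hp
  have hp2 : p ≠ 2 := by omega
  have hn := odd_orderOf_four hp2 hord
  have hcard := card_subgroupNegOneTwo hp2 hn
  obtain ⟨n, hn'⟩ : ∃ n, orderOf (4 : ZMod p) = n := ⟨_, rfl⟩
  rw [hn'] at hn hcard
  have hpn : p = 2 * n * ℓ + 1 := by
    have h := (subgroupNegOneTwo p).card_mul_index
    rw [hcard, ← hindex, Nat.card_eq_fintype_card, ZMod.card_units] at h
    omega
  have h2 : (2 : ZMod p) ^ (2 * n) = 1 := by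
    rw [pow_mul, show (2 : ZMod p) ^ 2 = 4 by norm_num, ← hn', pow_orderOf_eq_one]
  have hW' : ¬ (p : ℤ) ^ 2 ∣ 4 ^ n - 1 := by
    intro h
    apply hW
    have h1 : (4 : ℤ) ^ n - 1 ∣ 2 ^ (p - 1) - 1 := by
      have := sub_dvd_pow_sub_pow ((4 : ℤ) ^ n) 1 ℓ
      have e : ((4 : ℤ) ^ n) ^ ℓ = 2 ^ (p - 1) := by
        rw [show (4 : ℤ) = 2 ^ 2 by norm_num, ← pow_mul, ← pow_mul, hpn, Nat.add_sub_cancel,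
          mul_assoc]
      rwa [one_pow, e] at this
    refine (Nat.modEq_iff_dvd.2 ?_).symm
    push_cast
    exact h.trans h1
  have hupper : ∀ D : Finset (Finset (ZMod (p ^ k))), IsCAC (p ^ k) 3 D → _ := fun D hD =>
    hD.card_le_of_prime_pow hp3 hn hodd h2 hpn
  obtain ⟨C₀, hC₀, hC₀card⟩ := exists_isCAC_of_prime_pow hp2 hn' hW' hn hprime hodd hpn h2 k
  refine ⟨⟨C₀, hC₀, fun D hD => hC₀card ▸ hupper D hD⟩, fun C hC => ?_⟩
  rw [le_antisymm (hupper C hC.isCAC) (hC₀card ▸ hC.card_le C₀ hC₀), sum_level_card_eq hpn hn]
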